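/- Let $B\subseteq\mathbb{R}^2$ be open and let $\delta\xi = F_1\,dx_1 + F_2\,dx_2$ be a Pfaffian form on $B$, where $F_1,F_2: B\to\mathbb{R}$ are of class $C^\infty$. Assume that $\delta\xi$ is non-singular in the sense that it vanishes at no point of $B$: for every $x\in B$, $(F_1(x),F_2(x))\neq(0,0)$. Then $\delta\xi$ is locally integrable on $B$: for every point $p\in B$ there are an open neighbourhood $M\subseteq B$ of $p$ and functions $\mu,\psi: M\to\mathbb{R}$ of class $C^\infty$ such that $\mu(x)\neq 0$ for every $x\in M$ and $$\delta\xi = \mu\,d\psi \quad\text{on } M,$$ that is, $F_i = \mu\,\partial\psi/\partial x_i$ on $M$ for $i=1,2$. -/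

import Mathlib

open scoped ContDiff

/-- A Pfaffian form `F₁ dx₁ + ⋯ + Fₙ dxₙ` in `n` variables on a set `B ⊆ ℝⁿ`: its coefficient
functions, which are of class `C^∞` on `B`. Values off `B` are irrelevant. -/
structure PfaffianForm (n : ℕ) (B : Set (EuclideanSpace ℝ (Fin n))) where
  coeff : Fin n → EuclideanSpace ℝ (Fin n) → ℝ
  smooth : ∀ i, ContDiffOn ℝ ∞ (coeff i) B

namespace PfaffianForm

variable {n : ℕ} {B : Set (EuclideanSpace ℝ (Fin n))}

/-- The covector `∑ i, Fᵢ(x) dxᵢ` at the point `x`; `EuclideanSpace.proj i` is the coordinate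
differential `dxᵢ`. -/
noncomputable def toCovector (ξ : PfaffianForm n B) (x : EuclideanSpace ℝ (Fin n)) :
    EuclideanSpace ℝ (Fin n) →L[ℝ] ℝ :=
  ∑ i, ξ.coeff i x • (EuclideanSpace.proj i : EuclideanSpace ℝ (Fin n) →L[ℝ] ℝ)

/-- The form vanishes at no point of `B`. -/
def NonSingular (ξ : PfaffianForm n B) : Prop :=
  ∀ x ∈ B, ξ.toCovector x ≠ 0

/-- `ξ = μ dψ` on `A`, with `C^∞` functions `μ`, `ψ` on `A` and `μ` without zeros on `A`. -/
def IntegrableOn (ξ : PfaffianForm n B) (A : Set (EuclideanSpace ℝ (Fin n))) : Prop :=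
  ∃ μ ψ : EuclideanSpace ℝ (Fin n) → ℝ,
    ContDiffOn ℝ ∞ μ A ∧ ContDiffOn ℝ ∞ ψ A ∧ (∀ x ∈ A, μ x ≠ 0) ∧
      ∀ x ∈ A, ξ.toCovector x = μ x • fderiv ℝ ψ x

/-- Every point of `B` has an open neighbourhood in `B` on which the form is integrable. -/
def LocallyIntegrable (ξ : PfaffianForm n B) : Prop :=
  ∀ p ∈ B, ∃ M : Set (EuclideanSpace ℝ (Fin n)),
    IsOpen M ∧ p ∈ M ∧ M ⊆ B ∧ ξ.IntegrableOn M

end PfaffianForm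

/-!
A nonzero covector `θ x` of the plane has a line as kernel, and this line is spanned by the vector
field `V = θ(w) v - θ(v) w`, where `v, w` is a fixed basis. A flow box for `V` provides coordinates
in which `V` is the first coordinate field; the second coordinate `ψ` is then a first integral of
`V`, so that `dψ` and `θ` have the same kernel and are proportional.

The flow box needs a flow that is `C^n` in time and initial value together. After rescaling time to
`[0, 1]`, the integral curve `s ↦ φ (t s, x)` is a zero of a `C^n` map on `C([0, 1], E)` with
parameters `t, x`, and for `t = 0` the partial derivative in the curve is the identity. Any
continuous flow therefore agrees with the implicit function and inherits its regularity.
-/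

open Filter Topology Set

section InverseFunction

variable {𝕜 E F G : Type*} [RCLike 𝕜] [NormedAddCommGroup E] [NormedSpace 𝕜 E]
  [NormedAddCommGroup F] [NormedSpace 𝕜 F] [CompleteSpace F] [NormedAddCommGroup G]
  [NormedSpace 𝕜 G] {n : ℕ∞ω}

theorem eventually_isInvertible_fderiv_comp_inr {f : E × F → G} {u : E × F}
    (hf : ContDiffAt 𝕜 n f u) (hn : n ≠ 0) (hu : (fderiv 𝕜 f u ∘L .inr 𝕜 E F).IsInvertible) :
    ∀ᶠ v in 𝓝 u, (fderiv 𝕜 f v ∘L .inr 𝕜 E F).IsInvertible := by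
  have hcont : ContinuousAt (fun v => fderiv 𝕜 f v ∘L .inr 𝕜 E F) u :=
    (hf.continuousAt_fderiv hn).clm_comp continuousAt_const
  obtain ⟨e, he⟩ := hu
  refine hcont.eventually ?_
  simp only [← he]
  exact e.nhds

variable [CompleteSpace E]

/- For `n = ∞` this is stronger than regularity at the base point, which only gives, for each finite
`k`, a neighbourhood depending on `k` on which the implicit function is `C^k`. -/
theorem eventually_contDiffAt_implicitFunction [CompleteSpace G] {f : E × F → G} {u : E × F}
    (hf : ∀ᶠ v in 𝓝 u, ContDiffAt 𝕜 n f v) (hn : n ≠ 0)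
    (hu : (fderiv 𝕜 f u ∘L .inr 𝕜 E F).IsInvertible) :
    ∀ᶠ x in 𝓝 u.1, ContDiffAt 𝕜 n (hf.self_of_nhds.implicitFunction hn hu) x := by
  set ψ := hf.self_of_nhds.implicitFunction hn hu
  have hψu : ψ u.1 = u.2 := hf.self_of_nhds.implicitFunction_apply_self hn hu
  have hψ : ContDiffAt 𝕜 n ψ u.1 := hf.self_of_nhds.contDiffAt_implicitFunction hn hu
  have hgraph : Tendsto (fun x => (x, ψ x)) (𝓝 u.1) (𝓝 u) := by
    simpa [hψu, ContinuousAt] using continuousAt_id.prodMk hψ.continuousAt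
  have hψc : ∀ᶠ x in 𝓝 u.1, ContinuousAt ψ x :=
    ((hψ.of_le (ENat.one_le_iff_ne_zero_withTop.2 hn)).eventually (by simp)).mono
      fun x hx => hx.continuousAt
  filter_upwards [hgraph.eventually hf, hψc,
    hgraph.eventually (eventually_isInvertible_fderiv_comp_inr hf.self_of_nhds hn hu),
    (hf.self_of_nhds.eventually_apply_implicitFunction hn hu).eventually_nhds]
    with x hfx hψx hinv hsol
  -- the implicit function based at the nearby point `(x, ψ x)` has the same germ as `ψ`
  refine (hfx.contDiffAt_implicitFunction hn hinv).congr_of_eventuallyEq ?_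
  have hgraph' : Tendsto (fun y => (y, ψ y)) (𝓝 x) (𝓝 (x, ψ x)) :=
    continuousAt_id.prodMk hψx
  filter_upwards [hgraph'.eventually (hfx.eventually_apply_eq_iff_implicitFunction hn hinv), hsol]
    with y hy hsoly
  exact (hy.1 (hsoly.trans hsol.self_of_nhds.symm)).symm

theorem exists_eventually_contDiffAt_localInverse {f : E → F} {f' : E ≃L[𝕜] F} {a : E}
    (hf : ∀ᶠ x in 𝓝 a, ContDiffAt 𝕜 n f x) (hn : n ≠ 0)
    (hf' : HasFDerivAt f (f' : E →L[𝕜] F) a) :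
    ∃ g : F → E, g (f a) = a ∧ (∀ᶠ y in 𝓝 (f a), ContDiffAt 𝕜 n g y) ∧
      (∀ᶠ x in 𝓝 a, g (f x) = x) ∧ ∀ᶠ y in 𝓝 (f a), f (g y) = y := by
  let Φ : F × E → F := fun z => f z.2 - z.1
  have hΦ : ∀ᶠ z in 𝓝 (f a, a), ContDiffAt 𝕜 n Φ z :=
    (continuous_snd.tendsto (f a, a)).eventually hf |>.mono fun z hz =>
      (hz.comp z contDiffAt_snd).sub contDiffAt_fst
  have hΦ' : (fderiv 𝕜 Φ (f a, a) ∘L .inr 𝕜 F E).IsInvertible := by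
    have h : HasFDerivAt Φ _ (f a, a) := (hf'.comp (f a, a) hasFDerivAt_snd).sub hasFDerivAt_fst
    refine ⟨f', ?_⟩
    rw [h.fderiv]
    ext
    simp
  have hΦa := hΦ.self_of_nhds
  refine ⟨hΦa.implicitFunction hn hΦ', hΦa.implicitFunction_apply_self hn hΦ',
    eventually_contDiffAt_implicitFunction hΦ hn hΦ', ?_, ?_⟩
  · have hgraph : Tendsto (fun x => (f x, x)) (𝓝 a) (𝓝 (f a, a)) :=
      hf'.continuousAt.prodMk continuousAt_id
    filter_upwards [hgraph.eventually (hΦa.eventually_apply_eq_iff_implicitFunction hn hΦ')]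
      with x hx
    exact hx.1 (by simp [Φ])
  · filter_upwards [hΦa.eventually_apply_implicitFunction hn hΦ'] with y hy
    simpa [Φ, sub_eq_zero] using hy

end InverseFunction

section Superposition

universe u

variable {K : Type*} [TopologicalSpace K] [CompactSpace K] {E F : Type u} [NormedAddCommGroup E]
  [NormedSpace ℝ E] [NormedAddCommGroup F] [NormedSpace ℝ F]

variable (K E F) in
/-- The pointwise application `(A, h) ↦ (x ↦ A x (h x))` of a continuous family of operators to a
continuous function, as a bounded bilinear map. It expresses the derivative of a superposition
operator `v ↦ g ∘ v`. -/
noncomputable def pointwiseApplyL : C(K, E →L[ℝ] F) →L[ℝ] C(K, E) →L[ℝ] C(K, F) :=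
  LinearMap.mkContinuous₂
    (LinearMap.mk₂ ℝ
      (fun (A : C(K, E →L[ℝ] F)) (h : C(K, E)) => (⟨fun x => A x (h x), by fun_prop⟩ : C(K, F)))
      (fun _ _ _ => by ext; simp) (fun _ _ _ => by ext; simp)
      (fun _ _ _ => by ext; simp) (fun _ _ _ => by ext; simp)) 1
    (fun A h => by
      rw [one_mul]
      refine (ContinuousMap.norm_le _ (by positivity)).2 fun x => ?_
      exact (A x).le_of_opNorm_le_of_le (A.norm_coe_le_norm x) (h.norm_coe_le_norm x))

theorem hasFDerivAt_continuousMap_comp {g : C(E, F)} {g' : C(E, E →L[ℝ] F)}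
    (hg : ∀ a, HasFDerivAt g (g' a) a) (u : C(K, E)) :
    HasFDerivAt (fun v : C(K, E) => g.comp v) (pointwiseApplyL K E F (g'.comp u)) u := by
  rw [hasFDerivAt_iff_isLittleO, Asymptotics.isLittleO_iff]
  intro ε hε
  obtain ⟨δ, hδ, hclose⟩ : ∃ δ > 0, ∀ x, ∀ a ∈ Metric.ball (u x) δ, ‖g' a - g' (u x)‖ ≤ ε := by
    obtain ⟨δ, hδ, h⟩ := Metric.mem_uniformity_dist.1
      ((isCompact_range u.continuous).uniformContinuousAt_of_continuousAt g'
        (fun a _ => g'.continuous.continuousAt) (Metric.dist_mem_uniformity hε))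
    refine ⟨δ, hδ, fun x a ha => ?_⟩
    rw [← dist_eq_norm, dist_comm]
    exact (h (Metric.mem_ball'.1 ha) (mem_range_self x)).le
  filter_upwards [Metric.ball_mem_nhds u hδ] with v hv
  refine (ContinuousMap.norm_le _ (by positivity)).2 fun x => ?_
  have hvx : v x ∈ Metric.ball (u x) δ := (ContinuousMap.dist_apply_le_dist x).trans_lt hv
  calc ‖g (v x) - g (u x) - g' (u x) (v x - u x)‖ ≤ ε * ‖v x - u x‖ :=
        (convex_ball (u x) δ).norm_image_sub_le_of_norm_hasFDerivWithin_le'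
          (fun a _ => (hg a).hasFDerivWithinAt) (hclose x) (Metric.mem_ball_self hδ) hvx
    _ ≤ ε * ‖v - u‖ := by
        gcongr
        exact (v - u).norm_coe_le_norm x

theorem contDiff_continuousMap_comp {n : ℕ∞} {g : C(E, F)} (hg : ContDiff ℝ n g) :
    ContDiff ℝ n fun v : C(K, E) => g.comp v := by
  refine contDiff_iff_forall_nat_le.2 fun m hm => ?_
  replace hg : ContDiff ℝ m g := hg.of_le (mod_cast hm)
  clear hm
  induction m generalizing F with
  | zero => exact contDiff_zero.2 (ContinuousMap.continuous_postcomp g)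
  | succ m ih =>
    obtain ⟨g', hg', hderiv⟩ := contDiff_succ_iff_hasFDerivAt.1 hg
    let γ : C(E, E →L[ℝ] F) := ⟨g', hg'.continuous⟩
    have hγ : ContDiff ℝ m fun v : C(K, E) => γ.comp v := ih hg'
    exact contDiff_succ_iff_hasFDerivAt.2 ⟨_, (pointwiseApplyL K E F).contDiff.comp hγ,
      hasFDerivAt_continuousMap_comp (g' := γ) hderiv⟩

end Superposition

section Primitive

variable {E : Type*} [NormedAddCommGroup E] [NormedSpace ℝ E]

variable (E) in
/-- The primitive `s ↦ ∫₀ˢ u` on `[0, 1]`, as a bounded operator on continuous functions. The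
integrand is extended to `ℝ` by constants so that interval integrals apply. -/
noncomputable def primitiveL : C(unitInterval, E) →L[ℝ] C(unitInterval, E) :=
  LinearMap.mkContinuous
    { toFun := fun u => ⟨fun s => ∫ τ in (0 : ℝ)..s, u.IccExtend zero_le_one τ,
        (intervalIntegral.continuous_primitive
          (fun _ _ => (u.IccExtend zero_le_one).continuous.intervalIntegrable _ _) 0).comp
          continuous_subtype_val⟩
      map_add' := fun u v => by
        ext s
        exact intervalIntegral.integral_add
          ((u.IccExtend zero_le_one).continuous.intervalIntegrable _ _)
          ((v.IccExtend zero_le_one).continuous.intervalIntegrable _ _)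
      map_smul' := fun c u => by
        ext s
        exact intervalIntegral.integral_smul c _ } 1
    (fun u => by
      rw [one_mul]
      refine (ContinuousMap.norm_le _ (norm_nonneg _)).2 fun s => ?_
      calc ‖∫ τ in (0 : ℝ)..s, u.IccExtend zero_le_one τ‖ ≤ ‖u‖ * |(s : ℝ) - 0| :=
            intervalIntegral.norm_integral_le_of_norm_le_const fun τ _ => u.norm_coe_le_norm _
        _ ≤ ‖u‖ := by
            rw [sub_zero, abs_of_nonneg s.2.1]
            exact mul_le_of_le_one_right (norm_nonneg _) s.2.2)

theorem primitiveL_eq_sub [CompleteSpace E] {u u' : C(unitInterval, E)} {β : ℝ → E}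
    (hu : ∀ s : unitInterval, u s = β s)
    (hβ : ∀ s : unitInterval, HasDerivAt β (u' s) s) (s : unitInterval) :
    primitiveL E u' s = u s - u 0 := by
  rw [hu, hu]
  refine intervalIntegral.integral_eq_sub_of_hasDerivAt (fun σ hσ => ?_)
    ((u'.IccExtend zero_le_one).continuous.intervalIntegrable _ _)
  rw [uIcc_of_le s.2.1] at hσ
  have hσ' : σ ∈ Icc (0 : ℝ) 1 := ⟨hσ.1, hσ.2.trans s.2.2⟩
  change HasDerivAt β (Set.IccExtend zero_le_one u' σ) σ
  rw [Set.IccExtend_of_mem _ _ hσ']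
  exact hβ ⟨σ, hσ'⟩

end Primitive

section LocalFlow

variable {E : Type*} [NormedAddCommGroup E] [NormedSpace ℝ E]

/-- `φ (t, x)` is a local flow of the vector field `V` around `p`: for `(t, x)` near `(0, p)`, the
curve `φ (·, x)` starts at `x` and is an integral curve of `V` at time `t`. -/
def IsLocalFlowAt (V : E → E) (p : E) (φ : ℝ × E → E) : Prop :=
  ∀ᶠ z in 𝓝 ((0 : ℝ), p),
    φ (0, z.2) = z.2 ∧ HasDerivAt (fun t => φ (t, z.2)) (V (φ z)) z.1

theorem exists_isLocalFlowAt_continuousAt [CompleteSpace E] {V : E → E} {p : E}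
    (hV : ContDiffAt ℝ 1 V p) :
    ∃ φ : ℝ × E → E, IsLocalFlowAt V p φ ∧ ContinuousAt φ (0, p) := by
  obtain ⟨ε, hε, a, r, L, K, hr, hpl⟩ := IsPicardLindelof.of_contDiffAt_one hV
  obtain ⟨α, hα, hαc⟩ :=
    (hpl 0).exists_forall_mem_closedBall_eq_hasDerivWithinAt_continuousOn
  have hball : Metric.closedBall p r ∈ 𝓝 p := Metric.closedBall_mem_nhds p hr
  have hIcc : ∀ t ∈ Ioo (0 - ε) (0 + ε), Icc (0 - ε) (0 + ε) ∈ 𝓝 t := fun t ht =>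
    Icc_mem_nhds ht.1 ht.2
  have h0 : (0 : ℝ) ∈ Ioo (0 - ε) (0 + ε) := by simpa using hε
  refine ⟨fun z => α z.swap, ?_, ?_⟩
  · filter_upwards [prod_mem_nhds (Ioo_mem_nhds h0.1 h0.2) hball] with z hz
    obtain ⟨hinit, hderiv⟩ := hα z.2 hz.2
    exact ⟨hinit, (hderiv z.1 (Ioo_subset_Icc_self hz.1)).hasDerivAt (hIcc z.1 hz.1)⟩
  · have h : ContinuousAt α (p, 0) := hαc.continuousAt (prod_mem_nhds hball (hIcc 0 h0))
    exact h.comp (f := Prod.swap) (x := ((0 : ℝ), p)) continuous_swap.continuousAt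

theorem IsLocalFlowAt.hasFDerivAt {V : E → E} {p : E} {φ : ℝ × E → E} (hφ : IsLocalFlowAt V p φ)
    (hd : DifferentiableAt ℝ φ (0, p)) :
    HasFDerivAt φ ((ContinuousLinearMap.fst ℝ ℝ E).smulRight (V p) +
      ContinuousLinearMap.snd ℝ ℝ E) (0, p) := by
  have hinit : ∀ᶠ x in 𝓝 p, φ (0, x) = x :=
    ((Continuous.prodMk_right (0 : ℝ)).tendsto p).eventually (hφ.mono fun z hz => hz.1)
  have htime : fderiv ℝ φ (0, p) (1, 0) = V p := by
    have h := hd.hasFDerivAt.comp_hasDerivAt (0 : ℝ)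
      ((hasDerivAt_id (0 : ℝ)).prodMk (hasDerivAt_const (0 : ℝ) p))
    simpa only [hinit.self_of_nhds] using h.unique hφ.self_of_nhds.2
  have hspace : fderiv ℝ φ (0, p) ∘L .inr ℝ ℝ E = .id ℝ E :=
    (hd.hasFDerivAt.comp p (hasFDerivAt_prodMk_right (0 : ℝ) p)).unique
      ((hasFDerivAt_id p).congr_of_eventuallyEq hinit)
  refine hd.hasFDerivAt.congr_fderiv ?_
  ext1
  · ext
    simp [htime]
  · rw [hspace]
    ext
    simp

/-- The defect of `u` in the integral equation `u s = x + t ∫₀ˢ V (u τ) dτ` of an integral curve of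
`V` starting at `x`. Time is rescaled by `t`, so that `t` becomes a parameter and all curves live
on `[0, 1]`. -/
noncomputable def integralDefect (V : C(E, E)) (z : (ℝ × E) × C(unitInterval, E)) :
    C(unitInterval, E) :=
  z.2 - ContinuousLinearMap.const ℝ unitInterval z.1.2 - z.1.1 • primitiveL E (V.comp z.2)

theorem contDiff_integralDefect {n : ℕ∞} {V : C(E, E)} (hV : ContDiff ℝ n V) :
    ContDiff ℝ n (integralDefect V) := by
  have hconst : ContDiff ℝ n fun z : (ℝ × E) × C(unitInterval, E) =>
      ContinuousLinearMap.const ℝ unitInterval z.1.2 :=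
    (ContinuousLinearMap.const ℝ unitInterval (M := E)).contDiff.comp contDiff_fst.snd
  have hprim : ContDiff ℝ n fun z : (ℝ × E) × C(unitInterval, E) => primitiveL E (V.comp z.2) :=
    (primitiveL E).contDiff.comp ((contDiff_continuousMap_comp hV).comp contDiff_snd)
  exact (contDiff_snd.sub hconst).sub (contDiff_fst.fst.smul hprim)

theorem integralDefect_zero_const (V : C(E, E)) (p : E) :
    integralDefect V ((0, p), .const unitInterval p) = 0 := by
  ext
  simp [integralDefect]

theorem integralDefect_eq_zero [CompleteSpace E] {V : C(E, E)} {α : ℝ → E} {t : ℝ}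
    {u : C(unitInterval, E)} (hu : ∀ s : unitInterval, u s = α (t * s))
    (hα : ∀ s : unitInterval, HasDerivAt α (V (α (t * s))) (t * s)) :
    integralDefect V ((t, α 0), u) = 0 := by
  have hderiv : ∀ s : unitInterval,
      HasDerivAt (fun σ => α (t * σ)) ((t • V.comp u) s) s := fun s => by
    simpa [hu, Function.comp_def] using
      (hα s).scomp (s : ℝ) ((hasDerivAt_id (s : ℝ)).const_mul t)
  ext s
  have hprim : t • primitiveL E (V.comp u) s = u s - u 0 := by
    simpa using primitiveL_eq_sub hu hderiv s
  simp [integralDefect, hprim, hu]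

theorem isInvertible_fderiv_integralDefect_comp_inr {n : ℕ∞} {V : C(E, E)} (hV : ContDiff ℝ n V)
    (hn : n ≠ 0) (p : E) (u : C(unitInterval, E)) :
    (fderiv ℝ (integralDefect V) ((0, p), u) ∘L
      .inr ℝ (ℝ × E) C(unitInterval, E)).IsInvertible := by
  have hd : HasFDerivAt (integralDefect V) _ ((0, p), u) :=
    ((contDiff_integralDefect hV).differentiable (by simpa using hn) _).hasFDerivAt
  have hpartial := hd.comp u (hasFDerivAt_prodMk_right ((0 : ℝ), p) u)
  have htime_zero : integralDefect V ∘ (fun v => (((0 : ℝ), p), v)) =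
      fun v => v - ContinuousLinearMap.const ℝ unitInterval p := by
    ext v
    simp [integralDefect]
  rw [htime_zero] at hpartial
  refine ⟨.refl ℝ _, ?_⟩
  exact ((hasFDerivAt_id u).sub_const _).unique hpartial

theorem IsLocalFlowAt.eventually_exists_integralDefect_eq_zero [CompleteSpace E] {V : C(E, E)}
    {p : E} {φ : ℝ × E → E} (hφ : IsLocalFlowAt V p φ) (hc : ContinuousAt φ (0, p))
    {N : Set C(unitInterval, E)} (hN : N ∈ 𝓝 (.const unitInterval p)) :
    ∀ᶠ z in 𝓝 ((0 : ℝ), p), ∃ u ∈ N, integralDefect V (z, u) = 0 ∧ u 1 = φ z := by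
  obtain ⟨ε, hε, hεN⟩ := Metric.mem_nhds_iff.1 hN
  have hp : φ (0, p) = p := hφ.self_of_nhds.1
  have hnear : ∀ᶠ z in 𝓝 ((0 : ℝ), p), φ z ∈ Metric.ball p ε :=
    hc.eventually (by rw [hp]; exact Metric.ball_mem_nhds p hε)
  obtain ⟨r, hr, hball⟩ := Metric.eventually_nhds_iff_ball.1 (hφ.and hnear)
  filter_upwards [Metric.ball_mem_nhds _ hr] with ⟨t, x⟩ hz
  have hmem : ∀ s : unitInterval, (t * s, x) ∈ Metric.ball ((0 : ℝ), p) r := fun s => by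
    rw [← ball_prod_same, mem_prod, mem_ball_zero_iff] at hz ⊢
    refine ⟨lt_of_le_of_lt ?_ hz.1, hz.2⟩
    rw [norm_mul]
    exact mul_le_of_le_one_right (norm_nonneg t) (by simpa [abs_of_nonneg s.2.1] using s.2.2)
  have hderiv : ∀ s : unitInterval,
      HasDerivAt (fun τ => φ (τ, x)) (V (φ (t * s, x))) (t * s) := fun s => (hball _ (hmem s)).1.2
  let u : C(unitInterval, E) :=
    ⟨fun s => φ (t * s, x), continuous_iff_continuousAt.2 fun s =>
      ContinuousAt.comp (g := fun τ => φ (τ, x)) (hderiv s).continuousAt (by fun_prop)⟩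
  have hu : u ∈ Metric.ball (.const unitInterval p) ε :=
    (ContinuousMap.dist_lt_iff hε).2 fun s => (hball _ (hmem s)).2
  have hx : φ (0, x) = x := (hball _ hz).1.1
  refine ⟨u, hεN hu, ?_, congrArg (fun τ => φ (τ, x)) (mul_one t)⟩
  simpa only [hx] using integralDefect_eq_zero (u := u) (fun _ => rfl) hderiv

theorem IsLocalFlowAt.eventually_contDiffAt [CompleteSpace E] {n : ℕ∞} {V : E → E} {p : E}
    {φ : ℝ × E → E} (hφ : IsLocalFlowAt V p φ) (hc : ContinuousAt φ (0, p))
    (hV : ContDiff ℝ n V) (hn : n ≠ 0) : ∀ᶠ z in 𝓝 ((0 : ℝ), p), ContDiffAt ℝ n φ z := by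
  let W : C(E, E) := ⟨V, hV.continuous⟩
  have hn' : (n : ℕ∞ω) ≠ 0 := by simpa using hn
  set u₀ : C(unitInterval, E) := .const unitInterval p
  have hdefect : ∀ᶠ w in 𝓝 (((0 : ℝ), p), u₀), ContDiffAt ℝ n (integralDefect W) w :=
    .of_forall fun w => (contDiff_integralDefect (V := W) hV).contDiffAt
  have hinv := isInvertible_fderiv_integralDefect_comp_inr (V := W) hV hn p u₀
  set U := hdefect.self_of_nhds.implicitFunction hn' hinv
  obtain ⟨A, hA, N, hN, huniq⟩ := mem_nhds_prod_iff.1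
    (hdefect.self_of_nhds.eventually_apply_eq_iff_implicitFunction hn' hinv)
  have heq : ∀ᶠ z in 𝓝 ((0 : ℝ), p), φ z = U z 1 := by
    filter_upwards [hA, hφ.eventually_exists_integralDefect_eq_zero (V := W) hc hN]
      with z hzA ⟨u, huN, hu, hu1⟩
    have hUz : U z = u :=
      (huniq (mk_mem_prod hzA huN)).1 (hu.trans (integralDefect_zero_const W p).symm)
    rw [hUz, hu1]
  filter_upwards [heq.eventually_nhds, eventually_contDiffAt_implicitFunction hdefect hn' hinv]
    with z hz hUz
  have heval : ContDiff ℝ n fun u : C(unitInterval, E) => u 1 :=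
    (ContinuousMap.evalCLM ℝ (M := E) (1 : unitInterval)).contDiff
  exact (heval.contDiffAt.comp z hUz).congr_of_eventuallyEq hz

end LocalFlow

section FlowBox

variable {E H : Type*} [NormedAddCommGroup E] [NormedSpace ℝ E] [NormedAddCommGroup H]
  [NormedSpace ℝ H] {V : E → E} {p : E}

theorem IsLocalFlowAt.hasFDerivAt_transversal {φ : ℝ × E → E} (hφ : IsLocalFlowAt V p φ)
    (hd : DifferentiableAt ℝ φ (0, p)) (e : (ℝ × H) ≃L[ℝ] E) (he : e (1, 0) = V p) :
    HasFDerivAt (fun y : ℝ × H => φ (y.1, p + e (0, y.2))) (e : ℝ × H →L[ℝ] E) 0 := by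
  let L : ℝ × H →L[ℝ] ℝ × E := (ContinuousLinearMap.fst ℝ ℝ H).prod
    ((e : ℝ × H →L[ℝ] E) ∘L .inr ℝ ℝ H ∘L .snd ℝ ℝ H)
  have hL : HasFDerivAt (fun y : ℝ × H => (y.1, p + e (0, y.2))) L 0 := by
    simpa [L] using L.hasFDerivAt.const_add ((0 : ℝ), p)
  have hbase : (((0 : ℝ × H).1, p + e (0, (0 : ℝ × H).2)) : ℝ × E) = (0, p) := by simp
  refine (HasFDerivAt.comp (0 : ℝ × H) (hbase ▸ hφ.hasFDerivAt hd) hL).congr_fderiv ?_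
  ext1 <;> ext <;> simp [L, he]

theorem eventually_fderiv_localInverse_apply {χ : ℝ × H → E} {g : E → ℝ × H}
    (hχV : ∀ᶠ y in 𝓝 (g p), HasDerivAt (fun t => χ (t, y.2)) (V (χ y)) y.1)
    (hg : ∀ᶠ x in 𝓝 p, DifferentiableAt ℝ g x) (hgχ : ∀ᶠ y in 𝓝 (g p), g (χ y) = y)
    (hχg : ∀ᶠ x in 𝓝 p, χ (g x) = x) : ∀ᶠ x in 𝓝 p, fderiv ℝ g x (V x) = (1, 0) := by
  have hgc : Tendsto g (𝓝 p) (𝓝 (g p)) := hg.self_of_nhds.continuousAt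
  filter_upwards [hg, hχg, hgc.eventually hχV, hgc.eventually hgχ.eventually_nhds]
    with x hgx hx hVx hid
  have hcurve : HasDerivAt (fun t => g (χ (t, (g x).2))) (fderiv ℝ g x (V x)) (g x).1 := by
    rw [hx] at hVx
    exact hgx.hasFDerivAt.comp_hasDerivAt_of_eq (g x).1 hVx hx.symm
  have hline : (fun t => g (χ (t, (g x).2))) =ᶠ[𝓝 (g x).1] fun t => (t, (g x).2) :=
    ((Continuous.prodMk_left (g x).2).tendsto (g x).1).eventually hid
  exact hcurve.unique
    (((hasDerivAt_id _).prodMk (hasDerivAt_const _ _)).congr_of_eventuallyEq hline)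

theorem exists_flowBox [CompleteSpace E] [CompleteSpace H] {n : ℕ∞} (hV : ContDiff ℝ n V)
    (hn : n ≠ 0) (e : (ℝ × H) ≃L[ℝ] E) (he : e (1, 0) = V p) :
    ∃ g : E → ℝ × H, (∀ᶠ x in 𝓝 p, ContDiffAt ℝ n g x) ∧
      HasFDerivAt g (e.symm : E →L[ℝ] ℝ × H) p ∧ ∀ᶠ x in 𝓝 p, fderiv ℝ g x (V x) = (1, 0) := by
  have hn' : (n : ℕ∞ω) ≠ 0 := by simpa using hn
  obtain ⟨φ, hφ, hφc⟩ := exists_isLocalFlowAt_continuousAt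
    (hV.contDiffAt.of_le (ENat.one_le_iff_ne_zero_withTop.2 hn') : ContDiffAt ℝ 1 V p)
  have hφs := hφ.eventually_contDiffAt hφc hV hn
  let σ : ℝ × H → ℝ × E := fun y => (y.1, p + e (0, y.2))
  have hσ : ContDiff ℝ n σ := by fun_prop
  have hσ0 : σ 0 = (0, p) := by simp [σ]
  have hσt : Tendsto σ (𝓝 0) (𝓝 (0, p)) := hσ.continuous.tendsto' _ _ hσ0
  let χ : ℝ × H → E := φ ∘ σ
  have hχ0 : χ 0 = p := by simpa only [χ, Function.comp_apply, hσ0] using hφ.self_of_nhds.1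
  have hχs : ∀ᶠ y in 𝓝 0, ContDiffAt ℝ n χ y :=
    (hσt.eventually hφs).mono fun y hy => hy.comp y hσ.contDiffAt
  have hχV : ∀ᶠ y in 𝓝 0, HasDerivAt (fun t => χ (t, y.2)) (V (χ y)) y.1 :=
    (hσt.eventually hφ).mono fun y hy => hy.2
  have hχ' : HasFDerivAt χ (e : ℝ × H →L[ℝ] E) 0 :=
    hφ.hasFDerivAt_transversal (hφs.self_of_nhds.differentiableAt hn') e he
  obtain ⟨g, hg0, hgs, hgχ, hχg⟩ := exists_eventually_contDiffAt_localInverse hχs hn' hχ'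
  rw [hχ0] at hg0 hgs hχg
  refine ⟨g, hgs, ?_, eventually_fderiv_localInverse_apply (hg0 ▸ hχV)
    (hgs.mono fun x hx => hx.differentiableAt hn') (hg0 ▸ hgχ) hχg⟩
  exact HasFDerivAt.of_local_left_inverse hgs.self_of_nhds.continuousAt (by rwa [hg0]) hχg

end FlowBox

section PlaneForms

variable {E : Type*} [NormedAddCommGroup E] [NormedSpace ℝ E]

theorem exists_continuousLinearEquiv_comp_eq_snd (hE : Module.finrank ℝ E = 2) {α : E →L[ℝ] ℝ}
    (hα : α ≠ 0) : ∃ e : (ℝ × ℝ) ≃L[ℝ] E, ∀ y, α (e y) = y.2 := by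
  have : FiniteDimensional ℝ E := .of_finrank_pos (by lia)
  obtain ⟨w, hw⟩ := α.toLinearMap.surjective (fun h => hα (ContinuousLinearMap.coe_injective h)) 1
  obtain ⟨v, hv, hv0⟩ := (Submodule.ne_bot_iff _).1
    (LinearMap.ker_ne_bot_of_finrank_lt (f := α.toLinearMap) (by simp [hE]))
  replace hv : α v = 0 := hv
  replace hw : α w = 1 := hw
  let T : ℝ × ℝ →ₗ[ℝ] E := (LinearMap.toSpanSingleton ℝ E v).coprod (.toSpanSingleton ℝ E w)
  have hαT : ∀ y, α (T y) = y.2 := fun y => by simp [T, hv, hw]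
  have hT : Function.Injective T := by
    refine (injective_iff_map_eq_zero T).2 fun y hy => ?_
    have hy2 : y.2 = 0 := by rw [← hαT, hy, map_zero]
    have hy1 : y.1 • v = 0 := by simpa [T, hy2] using hy
    exact Prod.ext ((smul_eq_zero_iff_left hv0).1 hy1) hy2
  exact ⟨(T.linearEquivOfInjective hT (by simp [hE])).toContinuousLinearEquiv, hαT⟩

/-- A vector field in the kernel of the form `θ`: writing `θ = θ₁ dx₁ + θ₂ dx₂` with respect to the
basis `v, w`, it is the field `(θ₂, -θ₁)`. -/
def kernelField (θ : E → E →L[ℝ] ℝ) (v w x : E) : E :=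
  θ x w • v - θ x v • w

theorem contDiff_kernelField {n : ℕ∞ω} {θ : E → E →L[ℝ] ℝ} (hθ : ContDiff ℝ n θ) (v w : E) :
    ContDiff ℝ n (kernelField θ v w) := by
  unfold kernelField
  fun_prop

theorem smul_eq_smul_of_apply_kernelField_eq_zero (e : (ℝ × ℝ) ≃L[ℝ] E) {θ : E → E →L[ℝ] ℝ}
    {x : E} {β : E →L[ℝ] ℝ} (hβ : β (kernelField θ (e (1, 0)) (e (0, 1)) x) = 0) :
    β (e (0, 1)) • θ x = θ x (e (0, 1)) • β := by
  simp only [kernelField, map_sub, map_smul, smul_eq_mul] at hβ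
  have hcomp : (β (e (0, 1)) • θ x) ∘L (e : ℝ × ℝ →L[ℝ] E) =
      (θ x (e (0, 1)) • β) ∘L (e : ℝ × ℝ →L[ℝ] E) := by
    ext
    · suffices β (e (0, 1)) * θ x (e (1, 0)) = θ x (e (0, 1)) * β (e (1, 0)) by simpa
      linarith
    · simp [mul_comm]
  ext z
  simpa using congr($hcomp (e.symm z))

theorem exists_eventually_eq_smul_fderiv (hE : Module.finrank ℝ E = 2) {n : ℕ∞} {m : ℕ∞ω}
    (hmn : m + 1 ≤ n) {θ : E → E →L[ℝ] ℝ} (hθ : ContDiff ℝ n θ) {p : E} (hp : θ p ≠ 0) :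
    ∃ μ ψ : E → ℝ, ∀ᶠ x in 𝓝 p, ContDiffAt ℝ m μ x ∧ ContDiffAt ℝ n ψ x ∧ μ x ≠ 0 ∧
      θ x = μ x • fderiv ℝ ψ x := by
  have : FiniteDimensional ℝ E := .of_finrank_pos (by lia)
  have : CompleteSpace E := FiniteDimensional.complete ℝ E
  have hn' : (n : ℕ∞ω) ≠ 0 := fun h => by simp [h] at hmn
  have hn : n ≠ 0 := by simpa using hn'
  obtain ⟨e, he⟩ := exists_continuousLinearEquiv_comp_eq_snd hE hp
  set w := e (0, 1)
  have hV : ContDiff ℝ n (kernelField θ (e (1, 0)) w) := contDiff_kernelField hθ _ _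
  obtain ⟨g, hgs, hg', hgV⟩ := exists_flowBox hV hn e (p := p) (by simp [kernelField, he, w])
  let ψ : E → ℝ := fun x => (g x).2
  have hψ' : HasFDerivAt ψ _ p := hg'.snd
  have hψw : fderiv ℝ ψ p w ≠ 0 := by
    rw [hψ'.fderiv]
    simp [w]
  have hψs : ∀ᶠ x in 𝓝 p, ContDiffAt ℝ n ψ x := hgs.mono fun x hx => hx.snd
  have hdψs : ∀ᶠ x in 𝓝 p, ContDiffAt ℝ m (fun y => fderiv ℝ ψ y w) x :=
    hψs.mono fun x hx => (hx.fderiv_right hmn).clm_apply contDiffAt_const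
  have hθs : ContDiff ℝ m fun x => θ x w :=
    (hθ.of_le (le_self_add.trans hmn)).clm_apply contDiff_const
  have hθw : θ p w ≠ 0 := by simp [w, he]
  refine ⟨fun x => θ x w / fderiv ℝ ψ x w, ψ, ?_⟩
  filter_upwards [hgs, hψs, hdψs, hgV, hdψs.self_of_nhds.continuousAt.eventually_ne hψw,
    hθs.continuous.continuousAt.eventually_ne hθw] with x hgx hψx hdψx hVx hne hθne
  have hker : fderiv ℝ ψ x (kernelField θ (e (1, 0)) w x) = 0 := by
    rw [(hgx.differentiableAt hn').hasFDerivAt.snd.fderiv]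
    simp [hVx]
  refine ⟨hθs.contDiffAt.div hdψx hne, hψx, div_ne_zero hθne hne, ?_⟩
  rw [div_eq_inv_mul, mul_smul, eq_inv_smul_iff₀ hne]
  exact smul_eq_smul_of_apply_kernelField_eq_zero e hker

theorem exists_contDiff_eventuallyEq [HasContDiffBump E] {F : Type*} [NormedAddCommGroup F]
    [NormedSpace ℝ F] {n : ℕ∞} {f : E → F} {s : Set E} (hs : IsOpen s) (hf : ContDiffOn ℝ n f s)
    {p : E} (hp : p ∈ s) : ∃ g : E → F, ContDiff ℝ n g ∧ g =ᶠ[𝓝 p] f := by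
  obtain ⟨r, hr, hrs⟩ := Metric.nhds_basis_closedBall.mem_iff.1 (hs.mem_nhds hp)
  let ρ : ContDiffBump p := ⟨r / 2, r, half_pos hr, half_lt_self hr⟩
  have htsupport : tsupport ρ ⊆ Metric.closedBall p r :=
    closure_minimal (ρ.support_eq.trans_subset Metric.ball_subset_closedBall)
      Metric.isClosed_closedBall
  refine ⟨fun x => ρ x • f x, contDiff_iff_contDiffAt.2 fun x => ?_, ?_⟩
  · by_cases hx : x ∈ s
    · exact ρ.contDiffAt.smul (hf.contDiffAt (hs.mem_nhds hx))
    · have hx' : x ∉ tsupport ρ := fun h => hx (hrs (htsupport h))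
      refine contDiffAt_const (c := (0 : F)) |>.congr_of_eventuallyEq ?_
      filter_upwards [notMem_tsupport_iff_eventuallyEq.1 hx'] with y hy
      rw [hy, Pi.zero_apply, zero_smul]
  · filter_upwards [ρ.eventuallyEq_one] with x hx
    rw [hx, Pi.one_apply, one_smul]

theorem theorem1_general (hE : Module.finrank ℝ E = 2) {n : ℕ∞} {m : ℕ∞ω} (hmn : m + 1 ≤ n)
    {B : Set E} (hB : IsOpen B) {θ : E → E →L[ℝ] ℝ} (hθ : ContDiffOn ℝ n θ B) {p : E}
    (hpB : p ∈ B) (hp : θ p ≠ 0) :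
    ∃ M : Set E, IsOpen M ∧ p ∈ M ∧ M ⊆ B ∧ ∃ μ ψ : E → ℝ, ContDiffOn ℝ m μ M ∧
      ContDiffOn ℝ n ψ M ∧ (∀ x ∈ M, μ x ≠ 0) ∧ ∀ x ∈ M, θ x = μ x • fderiv ℝ ψ x := by
  have : FiniteDimensional ℝ E := .of_finrank_pos (by lia)
  obtain ⟨η, hη, hηθ⟩ := exists_contDiff_eventuallyEq hB hθ hpB
  obtain ⟨μ, ψ, hμψ⟩ := exists_eventually_eq_smul_fderiv hE hmn hη (hηθ.self_of_nhds ▸ hp)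
  obtain ⟨M, hM, hMopen, hpM⟩ :=
    eventually_nhds_iff.1 ((hB.eventually_mem hpB).and (hηθ.and hμψ))
  refine ⟨M, hMopen, hpM, fun x hx => (hM x hx).1, μ, ψ, ?_, ?_, ?_, ?_⟩ <;>
    intro x hx <;>
    obtain ⟨-, hηx, hμ, hψ, hμ0, hx⟩ := hM x hx
  · exact hμ.contDiffWithinAt
  · exact hψ.contDiffWithinAt
  · exact hμ0
  · rw [← hηx, hx]

end PlaneForms

namespace PfaffianForm

theorem contDiffOn_toCovector {n : ℕ} {B : Set (EuclideanSpace ℝ (Fin n))} (ξ : PfaffianForm n B) :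
    ContDiffOn ℝ ∞ ξ.toCovector B :=
  ContDiffOn.sum fun i _ => (ξ.smooth i).smul contDiffOn_const

end PfaffianForm

theorem theorem1 (B : Set (EuclideanSpace ℝ (Fin 2))) (hB : IsOpen B)
    (ξ : PfaffianForm 2 B) (hξ : ξ.NonSingular) : ξ.LocallyIntegrable := fun p hp =>
  theorem1_general finrank_euclideanSpace_fin (n := ⊤) le_rfl hB ξ.contDiffOn_toCovector hp
    (hξ p hp)
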